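/- Let $n$ be a nonnegative integer and $E,A\in\mathbb{R}^{n\times n}$. Let $$\mathfrak{B}=\{x\in C^\infty(\mathbb{R},\mathbb{R}^n) : \tfrac{d}{dt}\big(Ex(t)\big)=Ax(t)\ \text{for all } t\in\mathbb{R}\},\qquad \mathcal{V}=\{x(0) : x\in\mathfrak{B}\}\subseteq\mathbb{R}^n,$$ and $E\mathcal{V}=\{Ev : v\in\mathcal{V}\}$. The pencil $sE-A$ is called regular if $\det(sE-A)\in\mathbb{R}[s]$ is not the zero polynomial. Its spectrum $\sigma(E,A)$ is the set of all $\lambda\in\mathbb{C}$ for which $\lambda E-A$ is not invertible, and $\lambda\in\sigma(E,A)$ is called semi-simple if $\dim_{\mathbb{C}}\ker(\lambda E-A)$ equals the multiplicity of $\lambda$ as a root of $\det(sE-A)$. Then the following statements are equivalent. (a) $[E,A]$ is stable, that is, for every $x\in\mathfrak{B}$ there is $M\ge 0$ with $\sup_{t\ge 0}\|x(t)\|\le M$, where $\|\cdot\|$ is the Euclidean norm. (b) $sE-A$ is regular, and there is a symmetric matrix $X\in\mathbb{R}^{n\times n}$ such that $y^TXy>0$ for all $y\in E\mathcal{V}\setminus\{0\}$,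 $X(E\mathcal{V})=E\mathcal{V}$, and $v^T(A^TXE+E^TXA)v\le 0$ for all $v\in\mathcal{V}$. (c) $sE-A$ is regular, every $\lambda\in\sigma(E,A)$ satisfies $\operatorname{Re}\lambda\le 0$, and every $\lambda\in\sigma(E,A)$ with $\operatorname{Re}\lambda=0$ is semi-simple. -/

import Mathlib

open scoped ContDiff Matrix

noncomputable section

namespace DAE

/-- The matrix pencil `sE - A`, as a square matrix over `ℝ[s]`. -/
def pencil {n : ℕ} (E A : Matrix (Fin n) (Fin n) ℝ) :
    Matrix (Fin n) (Fin n) (Polynomial ℝ) :=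
  (Polynomial.X : Polynomial ℝ) • E.map Polynomial.C - A.map Polynomial.C

/-- The pencil `sE - A` is regular: `det (sE - A)` is not the zero polynomial. -/
def IsRegularPencil {n : ℕ} (E A : Matrix (Fin n) (Fin n) ℝ) : Prop :=
  (pencil E A).det ≠ 0

/-- The complex matrix `μ E - A`. -/
def evalPencil {n : ℕ} (E A : Matrix (Fin n) (Fin n) ℝ) (μ : ℂ) :
    Matrix (Fin n) (Fin n) ℂ :=
  μ • E.map Complex.ofReal - A.map Complex.ofReal

/-- The spectrum `σ(E, A)`: all complex `μ` for which `μ E - A` is not invertible. -/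
def pencilSpectrum {n : ℕ} (E A : Matrix (Fin n) (Fin n) ℝ) : Set ℂ :=
  {μ | ¬ IsUnit (evalPencil E A μ)}

/-- `μ` is semi-simple: the complex dimension of `ker (μ E - A)` equals the multiplicity of `μ`
as a root of `det (sE - A)`. -/
def IsSemisimpleAt {n : ℕ} (E A : Matrix (Fin n) (Fin n) ℝ) (μ : ℂ) : Prop :=
  Module.finrank ℂ (LinearMap.ker (Matrix.toLin' (evalPencil E A μ))) =
    ((pencil E A).det.map (algebraMap ℝ ℂ)).rootMultiplicity μ

/-- The behavior of `[E, A]`: the space of all `x ∈ C^∞(ℝ, ℝⁿ)` with `d/dt (E x) = A x` on `ℝ`. -/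
def behavior {n : ℕ} (E A : Matrix (Fin n) (Fin n) ℝ) : Submodule ℝ (ℝ → Fin n → ℝ) where
  carrier := {x | ContDiff ℝ ∞ x ∧ ∀ t : ℝ, HasDerivAt (fun s => E *ᵥ x s) (A *ᵥ x t) t}
  zero_mem' := by
    refine ⟨contDiff_const, fun t => ?_⟩
    simpa using hasDerivAt_const t (0 : Fin n → ℝ)
  add_mem' := by
    rintro x y ⟨hx, hx'⟩ ⟨hy, hy'⟩
    refine ⟨hx.add hy, fun t => ?_⟩
    simpa only [Pi.add_apply, Matrix.mulVec_add] using (hx' t).fun_add (hy' t)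
  smul_mem' := by
    rintro c x ⟨hx, hx'⟩
    refine ⟨contDiff_const.smul hx, fun t => ?_⟩
    simpa only [Pi.smul_apply, Matrix.mulVec_smul] using (hx' t).fun_const_smul c

/-- `[E, A]` is stable: every trajectory of the behavior is bounded on `[0, ∞)`
(in the Euclidean norm). -/
def IsStable {n : ℕ} (E A : Matrix (Fin n) (Fin n) ℝ) : Prop :=
  ∀ x ∈ behavior E A, ∃ M : ℝ, 0 ≤ M ∧ ∀ t : ℝ, 0 ≤ t → ‖WithLp.toLp 2 (x t)‖ ≤ M

/-- The system space `{x(0) | x in the behavior of [E, A]}`. -/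
def systemSpace {n : ℕ} (E A : Matrix (Fin n) (Fin n) ℝ) : Submodule ℝ (Fin n → ℝ) :=
  (behavior E A).map (LinearMap.proj (0 : ℝ))

/-- `M ≤_L N` for symmetric `M` and `N`: `xᵀ M x ≤ xᵀ N x` for all `x ∈ L`. -/
def LeOn {n : ℕ} (L : Submodule ℝ (Fin n → ℝ)) (M N : Matrix (Fin n) (Fin n) ℝ) : Prop :=
  ∀ x ∈ L, x ⬝ᵥ (M *ᵥ x) ≤ x ⬝ᵥ (N *ᵥ x)

/-- `M <_L N` for symmetric `M` and `N`: `xᵀ M x < xᵀ N x` for all nonzero `x ∈ L`. -/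
def LtOn {n : ℕ} (L : Submodule ℝ (Fin n → ℝ)) (M N : Matrix (Fin n) (Fin n) ℝ) : Prop :=
  ∀ x ∈ L, x ≠ 0 → x ⬝ᵥ (M *ᵥ x) < x ⬝ᵥ (N *ᵥ x)

/-- The image `M L` of the subspace `L` under the matrix `M`. -/
def image {n : ℕ} (M : Matrix (Fin n) (Fin n) ℝ) (L : Submodule ℝ (Fin n → ℝ)) :
    Submodule ℝ (Fin n → ℝ) :=
  L.map (Matrix.toLin' M)

end DAE

end

/-! Let `V = systemSpace E A`. Differentiating trajectories gives `A V ⊆ E V`. For a regular pencil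
a dimension count then makes `E` injective on `V`, so `E⁻¹A` makes sense on `V` and on its
complexification.

(a) ⇒ (c): a Jordan chain of length one or two at `μ` produces trajectories `e^{μt}(a + tb)`. Their
boundedness (`IsStable.exists_bound`) excludes `Re μ > 0`, and chains of length two when `Re μ = 0`.
A singular pencil has all of `ℂ` as spectrum, so regularity follows.
`finrank_ker_eq_rootMultiplicity_iff` links chains to root multiplicities by passing to the matrix
`(A - s₀E)⁻¹E`.

(c) ⇒ (b): `B = E⁻¹A` on the complexification of `V` inherits the spectral conditions, so
`exists_lyapunov_form` gives a real inner product with `β x (B x) ≤ 0`. Restricted to `V`, carried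
to `E V` by `E` and extended by zero on the orthogonal complement, it becomes the matrix `X`.

(b) ⇒ (a): `(Ex)ᵀX(Ex)` is nonincreasing along trajectories and dominates a positive multiple of
`‖x‖²` on `V`. -/

namespace Polynomial

/-! ### Roots of reversed polynomials. -/

theorem reverse_pow_of_domain {R : Type*} [Semiring R] [NoZeroDivisors R] [Nontrivial R]
    (p : R[X]) (k : ℕ) : (p ^ k).reverse = p.reverse ^ k := by
  induction k with
  | zero => simpa using reverse_C (1 : R)
  | succ k ih => rw [pow_succ, reverse_mul_of_domain, ih, pow_succ]

/-- Over a field reversal is multiplicative and sends `X - a` to a scalar multiple of `X - a⁻¹`.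
This translates between `det (X - N)` and `det (1 - X N)`. -/
theorem rootMultiplicity_reverse_inv {K : Type*} [Field K] {p : K[X]} (hp : p ≠ 0) {a : K}
    (ha : a ≠ 0) : p.reverse.rootMultiplicity a⁻¹ = p.rootMultiplicity a := by
  obtain ⟨q, hq, hndvd⟩ := p.exists_eq_pow_rootMultiplicity_mul_and_not_dvd hp a
  set m := p.rootMultiplicity a
  have hlin : (X - C a : K[X]).reverse = C (-a) * (X - C a⁻¹) := by
    have h1 : (X - C a : K[X]) = 1 * X + C (-a) := by simp [sub_eq_add_neg]
    have h2 : (1 : K[X]).reverse = 1 := by simpa using reverse_C (1 : K)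
    rw [h1, reverse_add_C, reverse_mul_X, h2, mul_sub, ← C_mul]
    simp [ha]
    ring
  have hq0 : q ≠ 0 := by rintro rfl; simp at hndvd
  have hroot : q.reverse.rootMultiplicity a⁻¹ = 0 := by
    apply rootMultiplicity_eq_zero
    intro h
    let : Invertible a := invertibleOfNonzero ha
    have h' := (eval₂_reverse_eq_zero_iff (RingHom.id K) a q).1 (by
      simpa [IsRoot.def, eval₂_id] using h)
    exact hndvd (dvd_iff_isRoot.2 (by simpa [eval₂_id] using h'))
  have hqr : q.reverse ≠ 0 := by simpa using hq0
  have hne : (X - C a⁻¹ : K[X]) ^ m * q.reverse ≠ 0 :=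
    mul_ne_zero (pow_ne_zero _ (X_sub_C_ne_zero _)) hqr
  have hC : (C ((-a) ^ m) : K[X]) ≠ 0 := by simpa using fun h => absurd h ha
  have hrev : p.reverse = C ((-a) ^ m) * ((X - C a⁻¹) ^ m * q.reverse) := by
    conv_lhs => rw [hq]
    rw [reverse_mul_of_domain, reverse_pow_of_domain, hlin, mul_pow, C_pow, mul_assoc]
  rw [hrev, rootMultiplicity_mul (mul_ne_zero hC hne), rootMultiplicity_mul hne,
    rootMultiplicity_C, rootMultiplicity_X_sub_C_pow, hroot]
  simp

end Polynomial

/-! ### Semi-simplicity through Jordan chains. -/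

namespace DAE

open Polynomial in
/-- The multiplicity of `μ` as a root of `det (sE - A)` is the dimension of a maximal generalized
eigenspace of `(A - s₀E)⁻¹E`. -/
theorem rootMultiplicity_det_eq_finrank {K : Type*} [Field K] {n : ℕ}
    (E A : Matrix (Fin n) (Fin n) K) {s₀ μ : K} (hμ : μ - s₀ ≠ 0) (hs : IsUnit (A - s₀ • E).det) :
    (((X : K[X]) • E.map C - A.map C).det).rootMultiplicity μ =
      Module.finrank K (Module.End.maxGenEigenspace
        (Matrix.toLin' ((A - s₀ • E)⁻¹ * E)) (μ - s₀)⁻¹) := by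
  set P := A - s₀ • E with hP
  set N := P⁻¹ * E with hN
  have hPN : P * N = E := by rw [hN, ← Matrix.mul_assoc, Matrix.mul_nonsing_inv _ hs, Matrix.one_mul]
  rw [LinearMap.finrank_maxGenEigenspace_eq, Matrix.charpoly_toLin',
    ← rootMultiplicity_reverse_inv (N.charpoly_monic.ne_zero) (inv_ne_zero hμ), inv_inv,
    Matrix.reverse_charpoly]
  -- The pencil factors as `-P (1 - (s - s₀) N)`, so its determinant is, up to a nonzero constant,
  -- the reversed characteristic polynomial of `N` at `s - s₀`.
  have hmat : (X : K[X]) • E.map C - A.map C =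
      (-P).map C * (1 - (X - C s₀) • N.map C) := by
    have h1 : P.map C * N.map C = E.map (C : K →+* K[X]) := by rw [← Matrix.map_mul, hPN]
    have h2 : (-P).map (C : K →+* K[X]) = - P.map C := by ext; simp
    have h3 : P.map (C : K →+* K[X]) = A.map C - C s₀ • E.map C := by ext; simp [hP]
    rw [h2, neg_mul, mul_sub, mul_smul_comm, h1, h3, mul_one, sub_smul]
    abel
  have hcomp : (1 - (X - C s₀) • N.map C).det = N.charpolyRev.comp (C 1 * X + C (-s₀)) := by
    rw [Matrix.charpolyRev, ← coe_compRingHom_apply, RingHom.map_det]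
    congr 1
    ext1 i j
    by_cases hij : i = j
    · simp [hij, sub_eq_add_neg]
      ring
    · simp [hij, sub_eq_add_neg]
      ring
  have hdet : ((-P).map (C : K →+* K[X])).det = C ((-P).det) := by
    rw [RingHom.map_det]; rfl
  have hrev : N.charpolyRev ≠ 0 := by
    intro h
    have := N.eval_charpolyRev
    simp [h] at this
  have hc : (-P).det ≠ 0 := by
    rw [Matrix.det_neg]; exact mul_ne_zero (by simp) hs.ne_zero
  have hcompmul : rootMultiplicity μ (N.charpolyRev.comp (C 1 * X + C (-s₀))) =
      rootMultiplicity (μ - s₀) N.charpolyRev := by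
    rw [rootMultiplicity_comp_C_mul_X_add_C _ _ _ _ isUnit_one]
    simp [sub_eq_add_neg]
  have hcomp0 : N.charpolyRev.comp (C 1 * X + C (-s₀)) ≠ 0 := by
    intro h
    rw [← hcomp] at h
    have := congrArg (eval s₀) h
    rw [hcomp, eval_comp] at this
    simp at this
  rw [hmat, Matrix.det_mul, hcomp, hdet, rootMultiplicity_mul
    (mul_ne_zero (by simpa using hc) hcomp0), rootMultiplicity_C, zero_add, hcompmul]

/-- If `ker g² = ker g`, then the kernels of all positive powers of `g` coincide. -/
theorem maxGenEigenspace_eq_eigenspace_iff {K V : Type*} [Field K] [AddCommGroup V] [Module K V]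
    (f : Module.End K V) (ν : K) :
    f.maxGenEigenspace ν = f.eigenspace ν ↔
      ∀ z, (f - algebraMap K _ ν) ((f - algebraMap K _ ν) z) = 0 → (f - algebraMap K _ ν) z = 0 := by
  set g := f - algebraMap K (Module.End K V) ν with hg
  have hmem : ∀ z, z ∈ f.maxGenEigenspace ν ↔ ∃ k : ℕ, (g ^ k) z = 0 := by
    intro z; rw [Module.End.mem_maxGenEigenspace]; rfl
  have hmem1 : ∀ z, z ∈ f.eigenspace ν ↔ g z = 0 := by
    intro z; rw [Module.End.eigenspace_def, LinearMap.mem_ker]; rfl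
  constructor
  · intro h z hz
    rw [← hmem1, ← h, hmem]
    exact ⟨2, by simpa [pow_two] using hz⟩
  · intro h
    refine le_antisymm (fun z hz => ?_) (fun z hz => ?_)
    · obtain ⟨k, hk⟩ := (hmem z).1 hz
      rw [hmem1]
      induction k with
      | zero => simp only [pow_zero, Module.End.one_apply] at hk; simp [hk]
      | succ k ih =>
        cases k with
        | zero => simpa using hk
        | succ k =>
          have hsucc : ∀ j, (g ^ (j + 1)) z = g ((g ^ j) z) := fun j => by rw [pow_succ']; rfl
          rw [hsucc (k + 1), hsucc k] at hk
          exact ih ((hsucc k).trans (h _ hk))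
    · exact (hmem z).2 ⟨1, by simpa using (hmem1 z).1 hz⟩

open Polynomial in
/-- A root `μ` of a regular pencil is semi-simple iff it admits no Jordan chain of length two. -/
theorem finrank_ker_eq_rootMultiplicity_iff {K : Type*} [Field K] [Infinite K] {n : ℕ}
    (E A : Matrix (Fin n) (Fin n) K) {μ : K} (hreg : ((X : K[X]) • E.map C - A.map C).det ≠ 0)
    (hμ : (μ • E - A).det = 0) :
    Module.finrank K (LinearMap.ker (Matrix.toLin' (μ • E - A))) =
        (((X : K[X]) • E.map C - A.map C).det).rootMultiplicity μ ↔
      ∀ z w : Fin n → K, (μ • E - A) *ᵥ w = 0 → (μ • E - A) *ᵥ z = E *ᵥ w → w = 0 := by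
  obtain ⟨s₀, hs₀⟩ : ∃ s, eval s ((X : K[X]) • E.map C - A.map C).det ≠ 0 := by
    by_contra! h
    exact hreg (Polynomial.funext fun r => by simpa using h r)
  have heval : ∀ s, eval s ((X : K[X]) • E.map C - A.map C).det = (s • E - A).det := by
    intro s
    rw [← coe_evalRingHom, RingHom.map_det]
    congr 1
    ext i j
    simp
    ring
  rw [heval] at hs₀
  have hμs : μ - s₀ ≠ 0 := by
    intro h
    rw [sub_eq_zero] at h
    exact hs₀ (h ▸ hμ)
  have hs : IsUnit (A - s₀ • E).det := by
    rw [← neg_sub, Matrix.det_neg]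
    exact (mul_ne_zero (by simp) hs₀).isUnit
  rw [rootMultiplicity_det_eq_finrank E A hμs hs]
  set P := A - s₀ • E with hP
  set N := P⁻¹ * E with hN
  set ν := (μ - s₀)⁻¹ with hν
  have hPN : P * N = E := by rw [hN, ← Matrix.mul_assoc, Matrix.mul_nonsing_inv _ hs, Matrix.one_mul]
  have hinj : ∀ v : Fin n → K, P *ᵥ v = 0 → v = 0 := fun v hv => by
    have := congrArg (P⁻¹ *ᵥ ·) hv
    simpa [Matrix.mulVec_mulVec, Matrix.nonsing_inv_mul _ hs] using this
  set g := Matrix.toLin' N - algebraMap K (Module.End K (Fin n → K)) ν with hg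
  -- With `g = N - ν`, the pencil at `μ` is `(μ - s₀) P g`; hence its kernel is that of `g`, where
  -- moreover `E = ν P`.
  have hgv : ∀ v, (μ • E - A) *ᵥ v = (μ - s₀) • (P *ᵥ (g v)) := by
    intro v
    have h1 : (μ - s₀) • g v = (μ - s₀) • (N *ᵥ v) - v := by
      simp [hg, Module.algebraMap_end_apply, smul_sub, smul_smul, hν, hμs]
    rw [← Matrix.mulVec_smul, h1, Matrix.mulVec_sub, Matrix.mulVec_smul, Matrix.mulVec_mulVec, hPN,
      hP]
    simp only [Matrix.sub_mulVec, Matrix.smul_mulVec, sub_smul]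
    abel
  have hker : ∀ v, (μ • E - A) *ᵥ v = 0 ↔ g v = 0 := by
    intro v
    rw [hgv, smul_eq_zero_iff_right hμs]
    exact ⟨hinj _, fun h => by rw [h, Matrix.mulVec_zero]⟩
  have hkerE : LinearMap.ker (Matrix.toLin' (μ • E - A)) =
      Module.End.eigenspace (Matrix.toLin' N) ν := by
    ext v
    rw [LinearMap.mem_ker, Matrix.toLin'_apply, hker, Module.End.mem_eigenspace_iff]
    simp [hg, sub_eq_zero, Module.algebraMap_end_apply]
  have hle : Module.End.eigenspace (Matrix.toLin' N) ν ≤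
      Module.End.maxGenEigenspace (Matrix.toLin' N) ν :=
    Module.End.genEigenspace_le_maximal _ _ 1
  have hEw : ∀ w, g w = 0 → E *ᵥ w = ν • (P *ᵥ w) := by
    intro w hw
    have : N *ᵥ w = ν • w := by
      simpa [hg, Module.algebraMap_end_apply, sub_eq_zero] using hw
    rw [← hPN, ← Matrix.mulVec_mulVec, this, Matrix.mulVec_smul]
  have hν0 : ν ≠ 0 := inv_ne_zero hμs
  trans (Module.End.maxGenEigenspace (Matrix.toLin' N) ν =
      Module.End.eigenspace (Matrix.toLin' N) ν)
  · rw [hkerE]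
    exact ⟨fun h => (Submodule.eq_of_le_of_finrank_eq hle h).symm, fun h => by rw [h]⟩
  rw [maxGenEigenspace_eq_eigenspace_iff]
  constructor
  · intro h z w hw hz
    have hgw := (hker w).1 hw
    have hPz : P *ᵥ ((μ - s₀) • g z - ν • w) = 0 := by
      rw [Matrix.mulVec_sub, Matrix.mulVec_smul, Matrix.mulVec_smul, ← hgv, hz, hEw w hgw, sub_self]
    have hzw : (μ - s₀) • g z = ν • w := sub_eq_zero.1 (hinj _ hPz)
    have hgz : g z = 0 := by
      apply h
      have := congrArg g hzw
      rw [map_smul, map_smul, hgw, smul_zero] at this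
      exact (smul_eq_zero_iff_right hμs).1 this
    rw [hgz, smul_zero] at hzw
    exact (smul_eq_zero_iff_right hν0).1 hzw.symm
  · intro h z hz
    -- One factor `ν` cancels `μ - s₀`; the other matches `E = ν P` on `ker g`.
    have := h (ν • ν • z) (g z) ((hker _).2 hz) (by
      rw [hgv, hEw _ hz, map_smul, map_smul, Matrix.mulVec_smul, Matrix.mulVec_smul, smul_smul]
      rw [hν, mul_inv_cancel₀ hμs, one_smul])
    exact this

/-! ### Lyapunov forms for complex endomorphisms. -/

/-- A finite-dimensional complex space carries a real inner product for which multiplication by `μ`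
has real part `Re μ`. -/
theorem exists_real_inner (F : Type*) [AddCommGroup F] [Module ℂ F] [FiniteDimensional ℂ F] :
    ∃ β : F →ₗ[ℝ] F →ₗ[ℝ] ℝ, (∀ x y, β x y = β y x) ∧ (∀ x, 0 ≤ β x x) ∧
      (∀ x, β x x = 0 → x = 0) ∧ ∀ (μ : ℂ) x, β x (μ • x) = μ.re * β x x := by
  let φ : F ≃ₗ[ℂ] EuclideanSpace ℂ (Fin (Module.finrank ℂ F)) :=
    LinearEquiv.ofFinrankEq _ _ (by simp)
  refine ⟨LinearMap.mk₂ ℝ (fun x y => (inner ℂ (φ x) (φ y)).re) ?_ ?_ ?_ ?_, ?_, ?_, ?_, ?_⟩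
  · intro x y z; simp
  · intro c x y
    rw [← Complex.coe_smul c x, map_smul, inner_smul_left]
    simp
  · intro x y z; simp
  · intro c x y
    rw [← Complex.coe_smul c y, map_smul, inner_smul_right]
    simp
  · intro x y
    simpa using inner_re_symm (𝕜 := ℂ) (φ x) (φ y)
  · intro x
    simpa using inner_self_nonneg (𝕜 := ℂ) (x := φ x)
  · intro x h
    have : RCLike.re (inner ℂ (φ x) (φ x)) = 0 := by simpa using h
    rw [inner_self_eq_norm_sq] at this
    simpa using this
  · intro μ x
    have h : (inner ℂ (φ x) (φ x)).im = 0 := inner_self_im (𝕜 := ℂ) (φ x)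
    rw [LinearMap.mk₂_apply, LinearMap.mk₂_apply, map_smul, inner_smul_right, Complex.mul_re, h]
    ring

section Lyapunov

variable {F : Type*} [AddCommGroup F] [Module ℂ F] [FiniteDimensional ℂ F]

/-- The Lyapunov form attached to one eigenvalue. -/
theorem exists_form_of_commute (B T : Module.End ℂ F) (hBT : Commute B T) (μ : ℂ) (m : ℕ)
    (hm : (B - algebraMap ℂ _ μ) ^ m * T = 0)
    (hμ : μ.re < 0 ∧ 0 < m ∨ μ.re = 0 ∧ (B - algebraMap ℂ _ μ) * T = 0) :
    ∃ β : F →ₗ[ℝ] F →ₗ[ℝ] ℝ, (∀ x y, β x y = β y x) ∧ (∀ x, 0 ≤ β x x) ∧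
      (∀ x, β x x = 0 → T x = 0) ∧ ∀ x, β x (B x) ≤ 0 := by
  obtain ⟨β, hsymm, hnonneg, hdef, hsmul⟩ := exists_real_inner F
  have hTB : ∀ x, T (B x) = B (T x) := fun x => (LinearMap.congr_fun hBT.eq x).symm
  set N := B - algebraMap ℂ (Module.End ℂ F) μ with hN
  have hB : ∀ x, B x = μ • x + N x := by intro x; simp [hN, Module.algebraMap_end_apply]
  rcases hμ with ⟨hμ, hm0⟩ | ⟨hμ, hNT⟩
  · set r := -μ.re with hr
    have hr0 : 0 < r := by linarith
    set c := (r ^ 2)⁻¹ with hc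
    have hc0 : 0 < c := by positivity
    let L : ℕ → F →ₗ[ℝ] F := fun k => (N ^ k * T).restrictScalars ℝ
    have hL : ∀ k x, L k x = (N ^ k * T) x := fun _ _ => rfl
    have hLB : ∀ k x, L k (B x) = μ • L k x + L (k + 1) x := by
      intro k x
      have hcomm : N ^ k * T * B = μ • (N ^ k * T) + N ^ (k + 1) * T := by
        have h1 : B = algebraMap ℂ (Module.End ℂ F) μ + N := by simp [hN]
        rw [mul_assoc, ← hBT.eq, ← mul_assoc, h1, mul_add, add_mul, ← Algebra.commutes,
          mul_assoc, ← Algebra.smul_def, pow_succ]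
      simpa [hL] using LinearMap.congr_fun hcomm x
    -- Young's inequality; `c = r⁻²` makes the last coefficient `1 / (2r)`.
    have hamgm : ∀ a b, β a b ≤ r / 2 * β a a + r / 2 * (c * β b b) := by
      intro a b
      have h := hnonneg (r • a - b)
      simp only [map_sub, map_smul, LinearMap.sub_apply, LinearMap.smul_apply, smul_eq_mul,
        hsymm b a] at h
      have h2 : r / 2 * (c * β b b) = β b b / (2 * r) := by rw [hc]; field_simp
      rw [h2, ← sub_nonneg]
      have : r / 2 * β a a + β b b / (2 * r) - β a b =
        (r * (r * β a a) - r * β a b - (r * β a b - β b b)) / (2 * r) := by field_simp; ring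
      rw [this]
      exact div_nonneg (by linarith) (by positivity)
    -- The weights `c ^ k` let the cross term with `L (k + 1)` be absorbed by the next summand, so
    -- the estimate telescopes; the `k = 0` term alone detects `T x`.
    refine ⟨∑ k ∈ Finset.range m, c ^ k • β.compl₁₂ (L k) (L k), ?_, ?_, ?_, ?_⟩
    · intro x y
      simp only [LinearMap.sum_apply, LinearMap.smul_apply, LinearMap.compl₁₂_apply]
      exact Finset.sum_congr rfl fun k _ => by rw [hsymm]
    · intro x
      simp only [LinearMap.sum_apply, LinearMap.smul_apply, LinearMap.compl₁₂_apply, smul_eq_mul]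
      exact Finset.sum_nonneg fun k _ => mul_nonneg (by positivity) (hnonneg _)
    · intro x hx
      simp only [LinearMap.sum_apply, LinearMap.smul_apply, LinearMap.compl₁₂_apply,
        smul_eq_mul] at hx
      rw [Finset.sum_eq_zero_iff_of_nonneg
        (fun k _ => mul_nonneg (by positivity) (hnonneg _))] at hx
      have := hx 0 (by simpa using hm0)
      simp only [pow_zero, one_mul] at this
      simpa [hL] using hdef _ this
    · intro x
      simp only [LinearMap.sum_apply, LinearMap.smul_apply, LinearMap.compl₁₂_apply, smul_eq_mul]
      let f : ℕ → ℝ := fun k => c ^ k * β (L k x) (L k x)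
      have hle : ∀ k ∈ Finset.range m, c ^ k * β (L k x) (L k (B x)) ≤
          r / 2 * (f (k + 1) - f k) := by
        intro k _
        rw [hLB, map_add, hsmul]
        have h := mul_le_mul_of_nonneg_left (hamgm (L k x) (L (k + 1) x))
          (pow_nonneg hc0.le k)
        have h2 : μ.re = -r := by rw [hr, neg_neg]
        simp only [f]
        rw [h2]
        calc _ = c ^ k * -(r * β (L k x) (L k x)) + c ^ k * β (L k x) (L (k + 1) x) := by ring
          _ ≤ _ := by
            refine (add_le_add_right h _).trans (le_of_eq ?_)
            ring
      refine (Finset.sum_le_sum hle).trans ?_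
      rw [← Finset.mul_sum, Finset.sum_range_sub]
      have hfm : f m = 0 := by simp only [f, hL, hm]; simp
      have hf0 : 0 ≤ f 0 := mul_nonneg (by positivity) (hnonneg _)
      rw [hfm]
      exact mul_nonpos_of_nonneg_of_nonpos (by positivity) (by linarith)
  -- Here `B` acts on the range of `T` as the purely imaginary scalar `μ`, so the form is conserved.
  · refine ⟨β.compl₁₂ (T.restrictScalars ℝ) (T.restrictScalars ℝ), fun x y => hsymm _ _,
      fun x => hnonneg _, fun x hx => hdef _ hx, fun x => ?_⟩
    have h0 : N (T x) = 0 := LinearMap.congr_fun hNT x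
    simp only [LinearMap.compl₁₂_apply, LinearMap.coe_restrictScalars]
    rw [hTB, hB, h0, add_zero, hsmul, hμ, zero_mul]

/-- An endomorphism whose eigenvalues lie in the closed left half plane, with the purely imaginary
ones semi-simple, is dissipative for some inner product. -/
theorem exists_lyapunov_form (B : Module.End ℂ F)
    (hre : ∀ (μ : ℂ) z, z ≠ 0 → B z = μ • z → μ.re ≤ 0)
    (hss : ∀ μ : ℂ, μ.re = 0 → ∀ z, (B - algebraMap ℂ _ μ) ((B - algebraMap ℂ _ μ) z) = 0 →
      (B - algebraMap ℂ _ μ) z = 0) :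
    ∃ β : F →ₗ[ℝ] F →ₗ[ℝ] ℝ, (∀ x y, β x y = β y x) ∧ (∀ x, x ≠ 0 → 0 < β x x) ∧
      ∀ x, β x (B x) ≤ 0 := by
  classical
  -- `q` is the characteristic polynomial without its factors `X - μ`; by Cayley–Hamilton `q(B)`
  -- maps into the generalized eigenspace of `μ`.
  have key : ∀ μ ∈ B.charpoly.roots.toFinset, ∃ (β : F →ₗ[ℝ] F →ₗ[ℝ] ℝ) (q : Polynomial ℂ),
      q.eval μ ≠ 0 ∧ (∀ x y, β x y = β y x) ∧ (∀ x, 0 ≤ β x x) ∧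
      (∀ x, β x x = 0 → Polynomial.aeval B q x = 0) ∧ ∀ x, β x (B x) ≤ 0 := by
    intro μ hμ
    have hp := B.charpoly_monic.ne_zero
    have hroot : B.charpoly.IsRoot μ := by
      rwa [Multiset.mem_toFinset, Polynomial.mem_roots hp] at hμ
    obtain ⟨z, hz⟩ := ((Module.End.hasEigenvalue_iff_isRoot_charpoly B μ).2 hroot).exists_hasEigenvector
    have hle := hre μ z hz.2 hz.apply_eq_smul
    obtain ⟨q, hq, hndvd⟩ := B.charpoly.exists_eq_pow_rootMultiplicity_mul_and_not_dvd hp μ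
    set m := B.charpoly.rootMultiplicity μ with hm
    have hm0 : 0 < m := (Polynomial.rootMultiplicity_pos hp).2 hroot
    have hzero : (B - algebraMap ℂ _ μ) ^ m * Polynomial.aeval B q = 0 := by
      have := B.aeval_self_charpoly
      rw [hq] at this
      simpa using this
    have hcomm : Commute B (Polynomial.aeval B q) := by
      have := congrArg (Polynomial.aeval B) (mul_comm Polynomial.X q)
      exact (commute_iff_eq _ _).2 (by simpa using this)
    obtain ⟨β, h1, h2, h3, h4⟩ := exists_form_of_commute B (Polynomial.aeval B q) hcomm μ m hzero (by
      rcases hle.lt_or_eq with h | h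
      · exact .inl ⟨h, hm0⟩
      · refine .inr ⟨h, LinearMap.ext fun x => ?_⟩
        have hmem : Polynomial.aeval B q x ∈ B.maxGenEigenspace μ := by
          rw [Module.End.mem_maxGenEigenspace]
          exact ⟨m, LinearMap.congr_fun hzero x⟩
        rw [(maxGenEigenspace_eq_eigenspace_iff B μ).2 (hss μ h), Module.End.mem_eigenspace_iff]
          at hmem
        simp [Module.algebraMap_end_apply, hmem])
    exact ⟨β, q, fun h => hndvd (Polynomial.dvd_iff_isRoot.2 h), h1, h2, h3, h4⟩
  choose! β q hq hsymm hnonneg hker hdiss using key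
  refine ⟨∑ μ ∈ B.charpoly.roots.toFinset, β μ, ?_, ?_, ?_⟩
  · intro x y
    simp only [LinearMap.sum_apply]
    exact Finset.sum_congr rfl fun μ hμ => hsymm μ hμ x y
  · intro x hx
    simp only [LinearMap.sum_apply]
    refine lt_of_le_of_ne (Finset.sum_nonneg fun μ hμ => hnonneg μ hμ x) fun h => hx ?_
    have h0 := (Finset.sum_eq_zero_iff_of_nonneg fun μ hμ => hnonneg μ hμ x).1 h.symm
    -- The common kernel of the `q_μ(B)` is `B`-invariant. If nonzero it would contain an
    -- eigenvector, for some `μ`, on which `q_μ(B)` acts as `q_μ(μ) ≠ 0`.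
    let K : Submodule ℂ F :=
      ⨅ μ ∈ B.charpoly.roots.toFinset, LinearMap.ker (Polynomial.aeval B (q μ))
    have hK : ∀ z, z ∈ K ↔ ∀ μ ∈ B.charpoly.roots.toFinset, Polynomial.aeval B (q μ) z = 0 := by
      intro z; simp [K, Submodule.mem_iInf]
    have hinv : ∀ z ∈ K, B z ∈ K := by
      intro z hz
      rw [hK] at hz ⊢
      intro μ hμ
      have hcomm : Polynomial.aeval B (q μ) * B = B * Polynomial.aeval B (q μ) := by
        have := congrArg (Polynomial.aeval B) (mul_comm (q μ) Polynomial.X)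
        simpa using this
      have := LinearMap.congr_fun hcomm z
      simpa [hz μ hμ] using this
    have hxK : x ∈ K := (hK x).2 fun μ hμ => hker μ hμ x (h0 μ hμ)
    by_contra hx0
    have : Nontrivial K := ⟨⟨⟨x, hxK⟩, 0, fun h => hx0 (congrArg Subtype.val h)⟩⟩
    obtain ⟨μ, hμ⟩ := Module.End.exists_eigenvalue (B.restrict hinv)
    obtain ⟨v, hv⟩ := hμ.exists_hasEigenvector
    have hv' : Module.End.HasEigenvector B μ v := by
      refine ⟨Module.End.mem_eigenspace_iff.2 ?_, fun h => hv.2 (Subtype.ext h)⟩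
      exact congrArg Subtype.val hv.apply_eq_smul
    have hmem : μ ∈ B.charpoly.roots.toFinset := by
      rw [Multiset.mem_toFinset, Polynomial.mem_roots B.charpoly_monic.ne_zero]
      exact (Module.End.hasEigenvalue_iff_isRoot_charpoly B μ).1
        (Module.End.hasEigenvalue_of_hasEigenvector hv')
    have h1 := Module.End.aeval_apply_of_hasEigenvector (p := q μ) hv'
    rw [(hK v).1 v.2 μ hmem] at h1
    exact (smul_ne_zero (hq μ hmem) hv'.2) h1.symm
  · intro x
    simp only [LinearMap.sum_apply]
    exact Finset.sum_nonpos fun μ hμ => hdiss μ hμ x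

end Lyapunov

/-! ### Inverting `E` on a subspace with `A W ⊆ E W`. -/

section Subspace

variable {K : Type*} [Field K] {n : ℕ} {E A : Matrix (Fin n) (Fin n) K}
  {W : Submodule K (Fin n → K)}

/-- If `A W ⊆ E W` and some `s₀E - A` is invertible, then `E` is injective on `W`. -/
theorem eq_zero_of_mulVec_eq_zero {s₀ : K} (hs₀ : (s₀ • E - A).det ≠ 0)
    (hA : ∀ v ∈ W, ∃ w ∈ W, A *ᵥ v = E *ᵥ w) {v : Fin n → K} (hv : v ∈ W) (hEv : E *ᵥ v = 0) :
    v = 0 := by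
  let f := (Matrix.toLin' E).domRestrict W
  let g := (Matrix.toLin' (s₀ • E - A)).domRestrict W
  have hg : Function.Injective g := by
    intro a b hab
    exact Subtype.ext (Matrix.mulVec_injective_iff_isUnit.2
      ((Matrix.isUnit_iff_isUnit_det _).2 hs₀.isUnit) hab)
  -- `(s₀E - A) W` has the dimension of `W` and lies in `E W`, so `E` loses no dimension on `W`.
  have hle : LinearMap.range g ≤ LinearMap.range f := by
    rintro _ ⟨a, rfl⟩
    obtain ⟨w, hw, hw'⟩ := hA a a.2
    refine ⟨s₀ • a - ⟨w, hw⟩, ?_⟩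
    simp [f, g, Matrix.mulVec_sub, Matrix.mulVec_smul, hw']
  have h1 := Submodule.finrank_mono hle
  rw [LinearMap.finrank_range_of_inj hg] at h1
  have h2 := f.finrank_range_add_finrank_ker
  have h3 : LinearMap.ker f = ⊥ := Submodule.finrank_eq_zero.1 (by lia)
  have h4 : (⟨v, hv⟩ : W) ∈ LinearMap.ker f := hEv
  rw [h3] at h4
  exact congrArg Subtype.val ((Submodule.mem_bot K).1 h4)

/-- If `A W ⊆ E W` and `E` is injective on `W`, then `E⁻¹A` is an endomorphism of `W`. -/
theorem exists_end_mulVec_eq (hA : ∀ v ∈ W, ∃ w ∈ W, A *ᵥ v = E *ᵥ w)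
    (hE : ∀ v ∈ W, E *ᵥ v = 0 → v = 0) :
    ∃ B : Module.End K W, ∀ v : W, E *ᵥ (B v : Fin n → K) = A *ᵥ v := by
  let f := (Matrix.toLin' E).domRestrict W
  have hf : Function.Injective f := by
    rw [← LinearMap.ker_eq_bot, LinearMap.ker_eq_bot']
    exact fun v hv => Subtype.ext (hE v v.2 hv)
  let g : W →ₗ[K] LinearMap.range f := ((Matrix.toLin' A).domRestrict W).codRestrict _ (by
    intro v
    obtain ⟨w, hw, h⟩ := hA v v.2
    exact ⟨⟨w, hw⟩, h.symm⟩)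
  refine ⟨(LinearEquiv.ofInjective f hf).symm.toLinearMap ∘ₗ g, fun v => ?_⟩
  exact congrArg Subtype.val ((LinearEquiv.ofInjective f hf).apply_symm_apply (g v))

end Subspace

/-! ### Trajectories, the system space and the energy estimate. -/

section Behavior

variable {n : ℕ} {E A : Matrix (Fin n) (Fin n) ℝ}

theorem hasDerivAt_mulVec (M : Matrix (Fin n) (Fin n) ℝ) {x : ℝ → Fin n → ℝ} {x' : Fin n → ℝ}
    {t : ℝ} (h : HasDerivAt x x' t) : HasDerivAt (fun s => M *ᵥ x s) (M *ᵥ x') t :=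
  (Matrix.toLin' M).toContinuousLinearMap.hasFDerivAt.comp_hasDerivAt t h

/-- The behavior is invariant under time shifts. -/
theorem apply_mem_systemSpace {x : ℝ → Fin n → ℝ} (hx : x ∈ behavior E A) (t : ℝ) :
    x t ∈ systemSpace E A := by
  refine ⟨fun s => x (s + t), ⟨hx.1.comp (contDiff_id.add contDiff_const), fun s => ?_⟩, by simp⟩
  exact (hx.2 (s + t)).comp_add_const s t

theorem mulVec_deriv_of_mem_behavior {x : ℝ → Fin n → ℝ} (hx : x ∈ behavior E A) (t : ℝ) :
    E *ᵥ deriv x t = A *ᵥ x t :=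
  (hasDerivAt_mulVec E ((hx.1.differentiable (by simp)) t).hasDerivAt).unique (hx.2 t)

theorem deriv_mem_behavior {x : ℝ → Fin n → ℝ} (hx : x ∈ behavior E A) :
    deriv x ∈ behavior E A := by
  refine ⟨(contDiff_infty_iff_deriv.1 hx.1).2, fun t => ?_⟩
  simp only [mulVec_deriv_of_mem_behavior hx]
  exact hasDerivAt_mulVec A ((hx.1.differentiable (by simp)) t).hasDerivAt

theorem exists_mulVec_eq_of_mem_systemSpace :
    ∀ v ∈ systemSpace E A, ∃ w ∈ systemSpace E A, A *ᵥ v = E *ᵥ w := by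
  rintro _ ⟨x, hx, rfl⟩
  exact ⟨deriv x 0, apply_mem_systemSpace (deriv_mem_behavior hx) 0,
    (mulVec_deriv_of_mem_behavior hx 0).symm⟩

theorem IsRegularPencil.exists_det_ne_zero (h : IsRegularPencil E A) :
    ∃ s : ℝ, (s • E - A).det ≠ 0 := by
  by_contra! hdet
  refine h (Polynomial.funext fun s => ?_)
  rw [← Polynomial.coe_evalRingHom, RingHom.map_det, Polynomial.coe_evalRingHom,
    Polynomial.eval_zero, ← hdet s]
  congr 1
  ext i j
  simp [pencil]
  ring

theorem IsRegularPencil.eq_zero_of_mem_systemSpace (h : IsRegularPencil E A) :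
    ∀ v ∈ systemSpace E A, E *ᵥ v = 0 → v = 0 := by
  obtain ⟨s, hs⟩ := h.exists_det_ne_zero
  exact fun v hv => eq_zero_of_mulVec_eq_zero hs exists_mulVec_eq_of_mem_systemSpace hv

/-- A continuous function homogeneous of degree two and positive on a subspace is bounded below by
a positive multiple of the squared norm. -/
theorem exists_pos_mul_sq_norm_le (W : Submodule ℝ (Fin n → ℝ)) (Q : (Fin n → ℝ) → ℝ)
    (hQ : Continuous Q) (hhom : ∀ (r : ℝ) v, Q (r • v) = r ^ 2 * Q v)
    (hpos : ∀ v ∈ W, v ≠ 0 → 0 < Q v) : ∃ c > 0, ∀ v ∈ W, c * ‖v‖ ^ 2 ≤ Q v := by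
  have hcomp : IsCompact (Metric.sphere (0 : Fin n → ℝ) 1 ∩ W) :=
    (isCompact_sphere _ _).inter_right W.closed_of_finiteDimensional
  have hmem : ∀ v ∈ W, v ≠ 0 → ‖v‖⁻¹ • v ∈ Metric.sphere (0 : Fin n → ℝ) 1 ∩ W := by
    intro v hv hv0
    refine ⟨?_, W.smul_mem _ hv⟩
    simp [norm_smul, hv0]
  have hzero : Q 0 = 0 := by simpa using hhom 0 0
  by_cases hne : (Metric.sphere (0 : Fin n → ℝ) 1 ∩ W).Nonempty
  · obtain ⟨u, hu, hmin⟩ := hcomp.exists_isMinOn hne hQ.continuousOn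
    refine ⟨Q u, hpos u hu.2 ?_, fun v hv => ?_⟩
    · rintro rfl
      simpa using hu.1
    · by_cases hv0 : v = 0
      · simp [hv0, hzero]
      have h := hmin (hmem v hv hv0)
      simp only [Set.mem_ofPred_eq, hhom] at h
      have hn : 0 < ‖v‖ := norm_pos_iff.2 hv0
      calc Q u * ‖v‖ ^ 2 ≤ (‖v‖⁻¹ ^ 2 * Q v) * ‖v‖ ^ 2 := by gcongr
        _ = Q v := by field_simp
  -- The unit sphere misses `W` only if `W = 0`, where any constant works.
  · refine ⟨1, one_pos, fun v hv => ?_⟩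
    by_cases hv0 : v = 0
    · simp [hv0, hzero]
    · exact (hne ⟨_, hmem v hv hv0⟩).elim

theorem dotProduct_lyapunov_mulVec {X : Matrix (Fin n) (Fin n) ℝ} (hX : X.IsSymm)
    (v : Fin n → ℝ) :
    v ⬝ᵥ ((Aᵀ * X * E + Eᵀ * X * A) *ᵥ v) = 2 * ((E *ᵥ v) ⬝ᵥ (X *ᵥ (A *ᵥ v))) := by
  have h : (A *ᵥ v) ⬝ᵥ (X *ᵥ (E *ᵥ v)) = (E *ᵥ v) ⬝ᵥ (X *ᵥ (A *ᵥ v)) := by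
    rw [Matrix.dotProduct_mulVec, dotProduct_comm, ← Matrix.mulVec_transpose, hX.eq]
  rw [Matrix.add_mulVec, dotProduct_add, ← Matrix.mulVec_mulVec, ← Matrix.mulVec_mulVec,
    ← Matrix.mulVec_mulVec, ← Matrix.mulVec_mulVec, Matrix.dotProduct_mulVec v Aᵀ,
    Matrix.dotProduct_mulVec v Eᵀ, Matrix.vecMul_transpose, Matrix.vecMul_transpose, h, two_mul]

theorem isStable_of_lyapunov (hreg : IsRegularPencil E A) {X : Matrix (Fin n) (Fin n) ℝ}
    (hX : X.IsSymm) (hpos : LtOn (image E (systemSpace E A)) 0 X)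
    (hle : LeOn (systemSpace E A) (Aᵀ * X * E + Eᵀ * X * A) 0) : IsStable E A := by
  intro x hx
  -- The energy; it is positive definite on the system space because `E` is injective there.
  let Q : (Fin n → ℝ) → ℝ := fun v => (E *ᵥ v) ⬝ᵥ (X *ᵥ (E *ᵥ v))
  obtain ⟨c, hc, hcQ⟩ := exists_pos_mul_sq_norm_le (systemSpace E A) Q
    (by simp only [Q]; fun_prop)
    (fun r v => by simp [Q, Matrix.mulVec_smul]; ring)
    (fun v hv hv0 => by
      have := hpos (E *ᵥ v) ⟨v, hv, rfl⟩ (fun h => hv0 (hreg.eq_zero_of_mem_systemSpace v hv h))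
      simpa only [Matrix.zero_mulVec, dotProduct_zero] using this)
  have hderiv : ∀ t, HasDerivAt (fun s => Q (x s))
      (x t ⬝ᵥ ((Aᵀ * X * E + Eᵀ * X * A) *ᵥ x t)) t := by
    intro t
    have h1 := hx.2 t
    have h2 := hasDerivAt_mulVec X h1
    have h3 : HasDerivAt (fun s => Q (x s)) (∑ i, ((A *ᵥ x t) i * (X *ᵥ (E *ᵥ x t)) i +
        (E *ᵥ x t) i * (X *ᵥ (A *ᵥ x t)) i)) t := by
      simp only [Q, dotProduct]
      exact HasDerivAt.fun_sum fun i _ => (hasDerivAt_pi.1 h1 i).mul (hasDerivAt_pi.1 h2 i)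
    convert h3 using 1
    rw [Finset.sum_add_distrib, dotProduct_lyapunov_mulVec hX, two_mul]
    congr 1
    change _ = (A *ᵥ x t) ⬝ᵥ (X *ᵥ (E *ᵥ x t))
    rw [Matrix.dotProduct_mulVec, dotProduct_comm, ← Matrix.mulVec_transpose, hX.eq]
  have hanti : Antitone fun s => Q (x s) :=
    antitone_of_hasDerivAt_nonpos hderiv fun t => by
      simpa using hle (x t) (apply_mem_systemSpace hx t)
  -- `Fin n → ℝ` carries the sup norm; the operator norm of `ι` pays for the Euclidean one.
  let ι : (Fin n → ℝ) →L[ℝ] EuclideanSpace ℝ (Fin n) :=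
    (WithLp.linearEquiv 2 ℝ (Fin n → ℝ)).symm.toLinearMap.toContinuousLinearMap
  refine ⟨‖ι‖ * √(Q (x 0) / c), by positivity, fun t ht => ?_⟩
  refine (ι.le_opNorm (x t)).trans ?_
  gcongr
  apply Real.le_sqrt_of_sq_le
  rw [le_div_iff₀ hc, mul_comm]
  exact (hcQ _ (apply_mem_systemSpace hx t)).trans (hanti ht)

end Behavior

/-! ### The complex pencil. -/

variable {n : ℕ} {E A : Matrix (Fin n) (Fin n) ℝ}

theorem re_map_ofReal_mulVec (M : Matrix (Fin n) (Fin n) ℝ) (z : Fin n → ℂ) :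
    (fun i => ((M.map Complex.ofReal *ᵥ z) i).re) = M *ᵥ fun i => (z i).re := by
  ext i; simp [Matrix.mulVec, dotProduct]

theorem im_map_ofReal_mulVec (M : Matrix (Fin n) (Fin n) ℝ) (z : Fin n → ℂ) :
    (fun i => ((M.map Complex.ofReal *ᵥ z) i).im) = M *ᵥ fun i => (z i).im := by
  ext i; simp [Matrix.mulVec, dotProduct]

theorem evalPencil_mulVec (μ : ℂ) (z : Fin n → ℂ) :
    evalPencil E A μ *ᵥ z =
      μ • (E.map Complex.ofReal *ᵥ z) - A.map Complex.ofReal *ᵥ z := by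
  rw [evalPencil, Matrix.sub_mulVec, Matrix.smul_mulVec]

theorem mem_pencilSpectrum_iff {μ : ℂ} :
    μ ∈ pencilSpectrum E A ↔ ∃ z, z ≠ 0 ∧ evalPencil E A μ *ᵥ z = 0 := by
  rw [Matrix.exists_mulVec_eq_zero_iff, pencilSpectrum, Set.mem_ofPred_eq,
    Matrix.isUnit_iff_isUnit_det, isUnit_iff_ne_zero, not_not]

theorem map_det_pencil : (pencil E A).det.map (algebraMap ℝ ℂ) =
    ((Polynomial.X : Polynomial ℂ) • (E.map Complex.ofReal).map Polynomial.C -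
      (A.map Complex.ofReal).map Polynomial.C).det := by
  rw [← Polynomial.coe_mapRingHom, RingHom.map_det]
  congr 1
  ext1 i j
  simp [pencil]

theorem isSemisimpleAt_iff (hreg : IsRegularPencil E A) {μ : ℂ} (hμ : μ ∈ pencilSpectrum E A) :
    IsSemisimpleAt E A μ ↔ ∀ z w : Fin n → ℂ, evalPencil E A μ *ᵥ w = 0 →
      evalPencil E A μ *ᵥ z = E.map Complex.ofReal *ᵥ w → w = 0 := by
  rw [IsSemisimpleAt, map_det_pencil]
  refine finrank_ker_eq_rootMultiplicity_iff _ _ ?_ ?_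
  · rw [← map_det_pencil]
    exact (Polynomial.map_ne_zero_iff (algebraMap ℝ ℂ).injective).2 hreg
  · exact Matrix.exists_mulVec_eq_zero_iff.1 (mem_pencilSpectrum_iff.1 hμ)

/-! ### Stability implies the spectral conditions. -/

section Necessity

/-- Along a stable system the complex trajectories `e^{μt}(a + tb)` are bounded for `t ≥ 0`. -/
theorem IsStable.exists_bound (h : IsStable E A) {μ : ℂ} {a b : Fin n → ℂ}
    (hb : evalPencil E A μ *ᵥ b = 0)
    (ha : evalPencil E A μ *ᵥ a = -(E.map Complex.ofReal *ᵥ b)) (i : Fin n) :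
    ∃ M : ℝ, ∀ t : ℝ, 0 ≤ t → Real.exp (μ.re * t) * ‖a i + t * b i‖ ≤ M := by
  let z : ℝ → Fin n → ℂ := fun t => Complex.exp (μ * t) • (a + (t : ℂ) • b)
  let z' : ℝ → Fin n → ℂ := fun t => Complex.exp (μ * t) • (μ • (a + (t : ℂ) • b) + b)
  have hz : ContDiff ℝ ∞ z := by
    have h1 : ContDiff ℝ ∞ (fun t : ℝ => (t : ℂ)) := Complex.ofRealCLM.contDiff
    exact (Complex.contDiff_exp.comp (contDiff_const.mul h1)).smul
      (contDiff_const.add (h1.smul contDiff_const))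
  have hderiv : ∀ t, HasDerivAt z (z' t) t := by
    intro t
    have h1 : HasDerivAt (fun t : ℝ => (t : ℂ)) 1 t := Complex.ofRealCLM.hasDerivAt
    have h2 := (h1.const_mul μ).cexp.smul ((h1.smul_const b).const_add a)
    have h3 : z' t = Complex.exp (μ * t) • (1 : ℂ) • b +
        (Complex.exp (μ * t) * (μ * 1)) • (a + (t : ℂ) • b) := by
      simp only [z', smul_add, smul_smul, one_smul, mul_one, mul_assoc]
      abel
    rw [h3]
    exact h2
  have hEA : ∀ t, E.map Complex.ofReal *ᵥ z' t = A.map Complex.ofReal *ᵥ z t := by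
    intro t
    rw [evalPencil_mulVec, sub_eq_zero] at hb
    rw [evalPencil_mulVec, sub_eq_iff_eq_add] at ha
    simp only [z, z', Matrix.mulVec_smul, Matrix.mulVec_add, smul_add]
    rw [ha, ← hb]
    simp only [smul_add, smul_neg, smul_smul]
    rw [mul_comm μ (t : ℂ)]
    abel
  have hre : (fun t i => (z t i).re) ∈ behavior E A := by
    refine ⟨contDiff_pi.2 fun i => Complex.reCLM.contDiff.comp (contDiff_pi.1 hz i), fun t => ?_⟩
    rw [← re_map_ofReal_mulVec, ← hEA, re_map_ofReal_mulVec]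
    exact hasDerivAt_mulVec E (hasDerivAt_pi.2 fun i =>
      Complex.reCLM.hasFDerivAt.comp_hasDerivAt t (hasDerivAt_pi.1 (hderiv t) i))
  have him : (fun t i => (z t i).im) ∈ behavior E A := by
    refine ⟨contDiff_pi.2 fun i => Complex.imCLM.contDiff.comp (contDiff_pi.1 hz i), fun t => ?_⟩
    rw [← im_map_ofReal_mulVec, ← hEA, im_map_ofReal_mulVec]
    exact hasDerivAt_mulVec E (hasDerivAt_pi.2 fun i =>
      Complex.imCLM.hasFDerivAt.comp_hasDerivAt t (hasDerivAt_pi.1 (hderiv t) i))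
  obtain ⟨M, -, hM⟩ := h _ hre
  obtain ⟨M', -, hM'⟩ := h _ him
  refine ⟨M + M', fun t ht => ?_⟩
  have h1 : |(z t i).re| ≤ M := (PiLp.norm_apply_le _ i).trans (hM t ht)
  have h2 : |(z t i).im| ≤ M' := (PiLp.norm_apply_le _ i).trans (hM' t ht)
  have h3 : ‖z t i‖ = Real.exp (μ.re * t) * ‖a i + t * b i‖ := by
    change ‖Complex.exp (μ * t) * (a i + t * b i)‖ = _
    rw [norm_mul, Complex.norm_exp]
    simp
  rw [← h3]
  exact (Complex.norm_le_abs_re_add_abs_im _).trans (add_le_add h1 h2)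

theorem IsStable.pencilSpectrum_subset (h : IsStable E A) :
    pencilSpectrum E A ⊆ {μ : ℂ | μ.re ≤ 0} := by
  intro μ hμ
  obtain ⟨a, ha0, ha⟩ := mem_pencilSpectrum_iff.1 hμ
  rw [Set.mem_ofPred_eq]
  by_contra! hre
  obtain ⟨i, hi⟩ := Function.ne_iff.1 ha0
  obtain ⟨M, hM⟩ := h.exists_bound (b := 0) (by simp) (by simpa using ha) i
  have hi0 : 0 < ‖a i‖ := norm_pos_iff.2 hi
  have hM0 : 0 ≤ M := le_trans (by positivity) (hM 0 le_rfl)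
  -- At this time `e^x ≥ 1 + x` already pushes the trajectory to `M + ‖a i‖`.
  have hbound := hM (M / (μ.re * ‖a i‖)) (by positivity)
  have hexp := Real.add_one_le_exp (μ.re * (M / (μ.re * ‖a i‖)))
  have h1 : μ.re * (M / (μ.re * ‖a i‖)) = M / ‖a i‖ := by field_simp
  rw [h1] at hexp hbound
  have h2 := mul_le_mul_of_nonneg_right hexp hi0.le
  have h3 : (M / ‖a i‖ + 1) * ‖a i‖ = M + ‖a i‖ := by field_simp
  simp only [Pi.zero_apply, mul_zero, add_zero] at hbound
  linarith

/-- If the determinant vanished identically, `1` would be a spectral value in the open right half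
plane. -/
theorem IsStable.isRegularPencil (h : IsStable E A) : IsRegularPencil E A := by
  intro hdet
  have hmem : (1 : ℂ) ∈ pencilSpectrum E A := by
    rw [mem_pencilSpectrum_iff, Matrix.exists_mulVec_eq_zero_iff]
    have h1 := congrArg (Polynomial.eval 1) (map_det_pencil (E := E) (A := A))
    rw [hdet, Polynomial.map_zero, Polynomial.eval_zero, ← Polynomial.coe_evalRingHom,
      RingHom.map_det] at h1
    rw [h1]
    congr 1
    ext i j
    simp [evalPencil]
  have := h.pencilSpectrum_subset hmem
  simp at this
  linarith

theorem IsStable.isSemisimpleAt (h : IsStable E A) {μ : ℂ} (hμ : μ ∈ pencilSpectrum E A)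
    (hre : μ.re = 0) : IsSemisimpleAt E A μ := by
  rw [isSemisimpleAt_iff h.isRegularPencil hμ]
  intro z w hw hz
  ext i
  obtain ⟨M, hM⟩ := h.exists_bound (a := -z) hw (by rw [Matrix.mulVec_neg, hz]) i
  simp only [hre, zero_mul, Real.exp_zero, one_mul] at hM
  by_contra hi
  have hi0 : 0 < ‖w i‖ := norm_pos_iff.2 hi
  have hM0 : 0 ≤ M := (norm_nonneg _).trans (hM 0 le_rfl)
  -- Chosen so that `t ‖w i‖ = M + ‖z i‖ + 1`, too large for `‖-z i + t w i‖ ≤ M`.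
  set t := (M + ‖z i‖ + 1) / ‖w i‖ with ht
  have ht0 : 0 ≤ t := by positivity
  have h1 := norm_sub_norm_le ((t : ℂ) * w i) (-(-z i))
  have h2 := hM t ht0
  have h3 : ‖(t : ℂ) * w i‖ = M + ‖z i‖ + 1 := by
    rw [norm_mul, Complex.norm_real, Real.norm_of_nonneg ht0, ht]
    field_simp
  rw [h3, sub_neg_eq_add, add_comm ((t : ℂ) * w i), neg_neg] at h1
  simp only [Pi.neg_apply] at h2
  linarith

end Necessity

/-! ### The spectral conditions give a Lyapunov matrix. -/

section Sufficiency

/-- The complexification of a real subspace, as a subspace of `ℂⁿ`. -/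
def complexify (V : Submodule ℝ (Fin n → ℝ)) : Submodule ℂ (Fin n → ℂ) where
  carrier := {z | (fun i => (z i).re) ∈ V ∧ (fun i => (z i).im) ∈ V}
  zero_mem' := ⟨V.zero_mem, V.zero_mem⟩
  add_mem' hz hw := ⟨V.add_mem hz.1 hw.1, V.add_mem hz.2 hw.2⟩
  smul_mem' c z hz := by
    refine ⟨?_, ?_⟩
    · convert V.sub_mem (V.smul_mem c.re hz.1) (V.smul_mem c.im hz.2) using 1
      ext i; simp
    · convert V.add_mem (V.smul_mem c.re hz.2) (V.smul_mem c.im hz.1) using 1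
      ext i; simp

theorem exists_map_ofReal_mulVec_eq {V : Submodule ℝ (Fin n → ℝ)}
    (hA : ∀ v ∈ V, ∃ w ∈ V, A *ᵥ v = E *ᵥ w) :
    ∀ z ∈ complexify V, ∃ w ∈ complexify V,
      A.map Complex.ofReal *ᵥ z = E.map Complex.ofReal *ᵥ w := by
  intro z hz
  obtain ⟨u, hu, hu'⟩ := hA _ hz.1
  obtain ⟨v, hv, hv'⟩ := hA _ hz.2
  have hre : (fun i => (((u i : ℂ) + v i * Complex.I)).re) = u := by ext i; simp
  have him : (fun i => (((u i : ℂ) + v i * Complex.I)).im) = v := by ext i; simp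
  refine ⟨fun i => u i + v i * Complex.I, ⟨by rwa [hre], by rwa [him]⟩, ?_⟩
  ext i
  apply Complex.ext
  · have h1 := congrFun (re_map_ofReal_mulVec A z) i
    have h2 := congrFun (re_map_ofReal_mulVec E fun i => u i + v i * Complex.I) i
    rw [hre] at h2
    rw [h1, h2, hu']
  · have h1 := congrFun (im_map_ofReal_mulVec A z) i
    have h2 := congrFun (im_map_ofReal_mulVec E fun i => u i + v i * Complex.I) i
    rw [him] at h2
    rw [h1, h2, hv']

theorem eq_zero_of_map_ofReal_mulVec_eq_zero {V : Submodule ℝ (Fin n → ℝ)}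
    (hE : ∀ v ∈ V, E *ᵥ v = 0 → v = 0) :
    ∀ z ∈ complexify V, E.map Complex.ofReal *ᵥ z = 0 → z = 0 := by
  intro z hz h
  have h1 := hE _ hz.1 (by rw [← re_map_ofReal_mulVec, h]; rfl)
  have h2 := hE _ hz.2 (by rw [← im_map_ofReal_mulVec, h]; rfl)
  ext i
  exact Complex.ext (congrFun h1 i) (congrFun h2 i)

theorem ofReal_mem_complexify {V : Submodule ℝ (Fin n → ℝ)} {v : Fin n → ℝ} (hv : v ∈ V) :
    (fun i => (v i : ℂ)) ∈ complexify V :=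
  ⟨by simpa using hv, V.zero_mem⟩

/-- The inclusion of a real subspace into its complexification. -/
def toComplexify (V : Submodule ℝ (Fin n → ℝ)) : V →ₗ[ℝ] complexify V where
  toFun v := ⟨fun i => (v.1 i : ℂ), ofReal_mem_complexify v.2⟩
  map_add' v w := by ext i; simp
  map_smul' c v := by ext i; simp

theorem toComplexify_injective (V : Submodule ℝ (Fin n → ℝ)) :
    Function.Injective (toComplexify V) := by
  intro v w h
  ext i
  exact Complex.ofReal_injective (congrFun (congrArg Subtype.val h) i)

theorem map_ofReal_mulVec_ofReal (M : Matrix (Fin n) (Fin n) ℝ) (v : Fin n → ℝ) :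
    M.map Complex.ofReal *ᵥ (fun i => (v i : ℂ)) = fun i => ((M *ᵥ v) i : ℂ) := by
  ext i; simp [Matrix.mulVec, dotProduct]

/-- A positive definite form on `V` for which `E⁻¹A` is dissipative. -/
theorem exists_form_systemSpace (hreg : IsRegularPencil E A)
    (hspec : pencilSpectrum E A ⊆ {μ : ℂ | μ.re ≤ 0})
    (hss : ∀ μ ∈ pencilSpectrum E A, μ.re = 0 → IsSemisimpleAt E A μ) :
    ∃ β : systemSpace E A →ₗ[ℝ] systemSpace E A →ₗ[ℝ] ℝ, (∀ x y, β x y = β y x) ∧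
      (∀ x, x ≠ 0 → 0 < β x x) ∧
      ∀ v w : systemSpace E A, A *ᵥ v.1 = E *ᵥ w.1 → β v w ≤ 0 := by
  set V := systemSpace E A
  have hEinj := eq_zero_of_map_ofReal_mulVec_eq_zero (V := V) hreg.eq_zero_of_mem_systemSpace
  obtain ⟨B, hB⟩ := exists_end_mulVec_eq (W := complexify V)
    (exists_map_ofReal_mulVec_eq exists_mulVec_eq_of_mem_systemSpace) hEinj
  -- `μE - A = -E (B - μ)` on the complexification, so eigenvectors and Jordan chains of `B` are
  -- those of the pencil up to sign.
  have heval : ∀ (μ : ℂ) (z : complexify V), evalPencil E A μ *ᵥ z.1 =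
      -(E.map Complex.ofReal *ᵥ ((B - algebraMap ℂ (Module.End ℂ (complexify V)) μ) z).1) := by
    intro μ z
    rw [evalPencil_mulVec, ← hB]
    simp [Module.algebraMap_end_apply, Matrix.mulVec_sub, Matrix.mulVec_smul]
  have hmem : ∀ (μ : ℂ) (z : complexify V), z ≠ 0 →
      (B - algebraMap ℂ (Module.End ℂ (complexify V)) μ) z = 0 → μ ∈ pencilSpectrum E A := by
    intro μ z hz h
    refine mem_pencilSpectrum_iff.2 ⟨z, fun h0 => hz (Subtype.ext h0), ?_⟩
    rw [heval, h]
    simp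
  obtain ⟨β, hsymm, hpos, hdiss⟩ := exists_lyapunov_form B
    (fun μ z hz h => hspec (hmem μ z hz (by simp [Module.algebraMap_end_apply, h])))
    (fun μ hμ z h => by
      by_contra hw
      set w := (B - algebraMap ℂ (Module.End ℂ (complexify V)) μ) z with hwz
      have hμs := hmem μ w hw h
      refine hw (Subtype.ext ((isSemisimpleAt_iff hreg hμs).1 (hss μ hμs hμ) (-z) w ?_ ?_))
      · rw [heval, h]; simp
      · rw [Matrix.mulVec_neg, heval, neg_neg])
  refine ⟨β.compl₁₂ (toComplexify V) (toComplexify V), fun x y => hsymm _ _,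
    fun x hx => hpos _ fun h => hx (toComplexify_injective V (by rw [h, map_zero])), ?_⟩
  intro v w hvw
  have hBv : B (toComplexify V v) = toComplexify V w := by
    have h1 : E.map Complex.ofReal *ᵥ (B (toComplexify V v) - toComplexify V w).1 = 0 := by
      rw [Submodule.coe_sub, Matrix.mulVec_sub, hB]
      change A.map Complex.ofReal *ᵥ (fun i => (v.1 i : ℂ)) -
        E.map Complex.ofReal *ᵥ (fun i => (w.1 i : ℂ)) = 0
      rw [map_ofReal_mulVec_ofReal, map_ofReal_mulVec_ofReal, hvw, sub_self]
    exact sub_eq_zero.1 (Subtype.ext (hEinj _ (Subtype.mem _) h1))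
  simpa [hBv] using hdiss (toComplexify V v)

/-- A positive definite form on a subspace `U` of `ℝⁿ` is represented by a symmetric matrix that
maps `U` onto itself. -/
theorem exists_matrix_of_form (U : Submodule ℝ (Fin n → ℝ)) (γ : U →ₗ[ℝ] U →ₗ[ℝ] ℝ)
    (hsymm : ∀ x y, γ x y = γ y x) (hpos : ∀ x, x ≠ 0 → 0 < γ x x) :
    ∃ X : Matrix (Fin n) (Fin n) ℝ, X.IsSymm ∧ image X U = U ∧
      ∀ x y : U, x.1 ⬝ᵥ (X *ᵥ y.1) = γ x y := by
  let D : LinearMap.BilinForm ℝ (Fin n → ℝ) := dotProductBilin ℝ ℝ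
  have hD : ∀ x y, D x y = x ⬝ᵥ y := fun _ _ => rfl
  have hrefl : D.IsRefl := fun x y h => by rw [hD, dotProduct_comm]; exact h
  have hnondeg : D.Nondegenerate := by
    refine ⟨fun x h => ?_, fun x h => ?_⟩ <;> exact dotProduct_self_eq_zero.1 (h x)
  have hcompl : IsCompl U (D.orthogonal U) := by
    rw [LinearMap.BilinForm.isCompl_orthogonal_iff_disjoint hrefl, Submodule.disjoint_def]
    exact fun x hx hx' => dotProduct_self_eq_zero.1 (hx' x hx)
  let G : (Fin n → ℝ) →ₗ[ℝ] U := U.projectionOnto _ hcompl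
  have hG : ∀ x : U, G x = x := Submodule.projectionOnto_apply_left hcompl
  have hG0 : ∀ x ∈ D.orthogonal U, G x = 0 := fun x hx =>
    (Submodule.projectionOnto_apply_eq_zero_iff hcompl).2 hx
  -- `G` is the orthogonal projection onto `U`, so `X` represents `γ` extended by zero to the
  -- orthogonal complement.
  set X := LinearMap.toMatrix₂' ℝ (γ.compl₁₂ G G) with hX
  have hXapp : ∀ x y, x ⬝ᵥ (X *ᵥ y) = γ (G x) (G y) := by
    intro x y
    rw [← Matrix.toLinearMap₂'_apply', hX, Matrix.toLinearMap₂'_toMatrix']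
    rfl
  have hXU : ∀ x y : U, x.1 ⬝ᵥ (X *ᵥ y.1) = γ x y := fun x y => by rw [hXapp, hG, hG]
  refine ⟨X, ?_, ?_, hXU⟩
  · ext i j
    rw [Matrix.transpose_apply, hX, LinearMap.toMatrix₂'_apply, LinearMap.toMatrix₂'_apply]
    exact hsymm _ _
  · have hle : image X U ≤ U := by
      rintro _ ⟨u, hu, rfl⟩
      -- `X u` is orthogonal to everything orthogonal to `U`, hence lies in `U`.
      rw [← LinearMap.BilinForm.orthogonal_orthogonal hnondeg hrefl U]
      intro w hw
      change w ⬝ᵥ (X *ᵥ u) = 0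
      rw [hXapp, hG0 w hw, map_zero, LinearMap.zero_apply]
    refine Submodule.eq_of_le_of_finrank_eq hle ?_
    have hinj : Function.Injective ((Matrix.toLin' X).domRestrict U) := by
      rw [← LinearMap.ker_eq_bot, LinearMap.ker_eq_bot']
      intro u hu
      by_contra h0
      have h1 := hpos u h0
      have h2 : X *ᵥ u.1 = 0 := hu
      rw [← hXU, h2, dotProduct_zero] at h1
      exact lt_irrefl _ h1
    rw [image, ← LinearMap.range_domRestrict, LinearMap.finrank_range_of_inj hinj]

/-- `E` is a bijection from the system space onto its image; transporting the form along it gives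
`(Ev)ᵀX(Ew) = β v w`, and all claims reduce to those on `β`. -/
theorem exists_lyapunov_matrix (hreg : IsRegularPencil E A)
    (hspec : pencilSpectrum E A ⊆ {μ : ℂ | μ.re ≤ 0})
    (hss : ∀ μ ∈ pencilSpectrum E A, μ.re = 0 → IsSemisimpleAt E A μ) :
    ∃ X : Matrix (Fin n) (Fin n) ℝ, X.IsSymm ∧
      LtOn (image E (systemSpace E A)) 0 X ∧
      image X (image E (systemSpace E A)) = image E (systemSpace E A) ∧
      LeOn (systemSpace E A) (Aᵀ * X * E + Eᵀ * X * A) 0 := by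
  obtain ⟨β, hsymm, hpos, hdiss⟩ := exists_form_systemSpace hreg hspec hss
  have hE := hreg.eq_zero_of_mem_systemSpace
  let f : systemSpace E A →ₗ[ℝ] image E (systemSpace E A) :=
    (Matrix.toLin' E).submoduleMap (systemSpace E A)
  have hf : Function.Bijective f := by
    refine ⟨?_, LinearMap.submoduleMap_surjective _ _⟩
    rw [← LinearMap.ker_eq_bot, LinearMap.ker_eq_bot']
    exact fun v hv => Subtype.ext (hE v v.2 (congrArg Subtype.val hv))
  let e := LinearEquiv.ofBijective f hf
  obtain ⟨X, hX, himage, hXU⟩ := exists_matrix_of_form (image E (systemSpace E A))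
    (β.compl₁₂ e.symm.toLinearMap e.symm.toLinearMap) (fun x y => hsymm _ _)
    (fun x hx => hpos _ (by simpa using hx))
  have hXE : ∀ v w : systemSpace E A, (E *ᵥ v.1) ⬝ᵥ (X *ᵥ (E *ᵥ w.1)) = β v w := by
    intro v w
    have := hXU (e v) (e w)
    simp only [LinearMap.compl₁₂_apply, LinearEquiv.coe_coe, LinearEquiv.symm_apply_apply] at this
    exact this
  refine ⟨X, hX, ?_, himage, ?_⟩
  · rintro _ ⟨v, hv, rfl⟩ hv0
    rw [Matrix.zero_mulVec, dotProduct_zero, Matrix.toLin'_apply, hXE ⟨v, hv⟩ ⟨v, hv⟩]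
    refine hpos _ fun h => hv0 ?_
    rw [show v = 0 from congrArg Subtype.val h, map_zero]
  · intro v hv
    obtain ⟨w, hw, hvw⟩ := exists_mulVec_eq_of_mem_systemSpace v hv
    rw [dotProduct_lyapunov_mulVec hX, hvw, hXE ⟨v, hv⟩ ⟨w, hw⟩, Matrix.zero_mulVec,
      dotProduct_zero]
    linarith [hdiss ⟨v, hv⟩ ⟨w, hw⟩ hvw]

end Sufficiency

end DAE

theorem proposition3p2 (n : ℕ) (E A : Matrix (Fin n) (Fin n) ℝ) :
    List.TFAE [
      DAE.IsStable E A,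
      DAE.IsRegularPencil E A ∧
        ∃ X : Matrix (Fin n) (Fin n) ℝ, X.IsSymm ∧
          DAE.LtOn (DAE.image E (DAE.systemSpace E A)) 0 X ∧
          DAE.image X (DAE.image E (DAE.systemSpace E A)) =
            DAE.image E (DAE.systemSpace E A) ∧
          DAE.LeOn (DAE.systemSpace E A) (Aᵀ * X * E + Eᵀ * X * A) 0,
      DAE.IsRegularPencil E A ∧
        DAE.pencilSpectrum E A ⊆ {μ : ℂ | μ.re ≤ 0} ∧
        ∀ μ ∈ DAE.pencilSpectrum E A, μ.re = 0 → DAE.IsSemisimpleAt E A μ] := by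
  tfae_have 1 → 3 := fun h =>
    ⟨h.isRegularPencil, h.pencilSpectrum_subset, fun _ hμ hre => h.isSemisimpleAt hμ hre⟩
  tfae_have 3 → 2 := fun ⟨hreg, hspec, hss⟩ =>
    ⟨hreg, DAE.exists_lyapunov_matrix hreg hspec hss⟩
  tfae_have 2 → 1 := fun ⟨hreg, _, hX, hpos, _, hle⟩ => DAE.isStable_of_lyapunov hreg hX hpos hle
  tfae_finish
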